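/- Let $\omega:[0,\infty)\to[0,\infty)$ be a continuous increasing (i.e. non-decreasing) function such that - $(\alpha)$ there is $A\ge 1$ with $\omega(2t)\le A(1+\omega(t))$ for all $t\ge 0$; - $(\beta)$ $\int_1^\infty \omega(t)\,t^{-2}\,dt<\infty$; - $(\gamma)'$ there are $a\in\mathbb{R}$, $b>0$ with $\omega(t)\ge a+b\log(1+t)$ for all $t\ge 0$; - $(\delta)$ $\varphi(t):=\omega(e^t)$ is convex on $[0,\infty)$. Write $\omega(z):=\omega\big(\sum_{j=1}^N|z_j|\big)$ for $z\in\mathbb{C}^N$, and $\varphi^*(y):=\sup_{x\ge 0}(xy-\varphi(x))\in(-\infty,+\infty]$ for $y\ge 0$, with the convention $e^{-\infty}=0$. For $z\in\mathbb{C}^N$ let $\hat f(z):=\int_{\mathbb{R}^N}f(t)e^{-i\langle t,z\rangle}\,dt$, where $\langle t,z\rangle=\sum_j t_jz_j$. Let $K\subset\mathbb{R}^N$ be a non-empty convex compact set with supporting function $H_K(\eta):=\sup_{x\in K}\langle x,\eta\rangle$. Let $\mathcal{D}(K)$ be the set of $f\in C^\infty(\mathbb{R}^N)$ (complex valued) with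 $\operatorname{supp}f\subset K$, and let $$\mathcal{D}_{(\omega)}(K):=\Big\{f\in\mathcal{D}(K):\ \int_{\mathbb{R}^N}|\hat f(t)|\,e^{\lambda\omega(t)}\,dt<\infty\ \text{ for all }\lambda>0\Big\}.$$ **Theorem (Paley–Wiener theorem for $\omega$-ultradifferentiable functions of Beurling type).** Let $f\in L^1(\mathbb{R}^N)$. The following are equivalent (in (1) and (2), membership means that $f$ agrees almost everywhere with an element of the space, with which it is identified): 1. $f\in\mathcal{D}_{(\omega)}(K)$; 2. $f\in\mathcal{D}(K)$ and, for every integer $k\ge 1$, $$\sup_{\alpha\in\mathbb{N}_0^N}\ \sup_{x\in\mathbb{R}^N}|f^{(\alpha)}(x)|\,e^{-k\varphi^*(|\alpha|/k)}<\infty;$$ 3. the integral $\hat f(z)$ converges absolutely for every $z\in\mathbb{C}^N$ and, for every integer $k\ge 1$, there is $C_k>0$ such that $$|\hat f(z)|\le C_k\,e^{H_K(\operatorname{Im}z)-k\omega(z)}\qquad\text{for all }z\in\mathbb{C}^N.$$ -/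

import Mathlib

open MeasureTheory Set
open scoped ENNReal

noncomputable section

namespace PaleyWienerBeurling

/-- Non-quasianalytic weight functions `ω ∈ 𝒲'`. The function `ω : [0,∞) → [0,∞)` is represented
by a function on `ℝ` of which only the values on `[0,∞)` are constrained or used. -/
structure IsWeight (ω : ℝ → ℝ) : Prop where
  nonneg : ∀ t, 0 ≤ t → 0 ≤ ω t
  continuousOn : ContinuousOn ω (Ici 0)
  monotoneOn : MonotoneOn ω (Ici 0)
  /-- condition (α) -/
  alpha : ∃ K : ℝ, 1 ≤ K ∧ ∀ t, 0 ≤ t → ω (2 * t) ≤ K * (1 + ω t)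
  /-- condition (β) -/
  beta : IntegrableOn (fun t => ω t / t ^ 2) (Ioi 1)
  /-- condition (γ)' -/
  gamma' : ∃ a b : ℝ, 0 < b ∧ ∀ t, 0 ≤ t → a + b * Real.log (1 + t) ≤ ω t
  /-- condition (δ) -/
  delta : ConvexOn ℝ (Ici 0) (fun t => ω (Real.exp t))

/-- The Young conjugate `φ*(y) = sup_{x ≥ 0} (x y - φ(x))` of `φ(x) = ω(eˣ)`. It takes values in
the extended reals: it is `+∞` for large `y` when `ω(t) = log (1 + t)`. -/
def youngConj (ω : ℝ → ℝ) (y : ℝ) : EReal :=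
  ⨆ x : Ici (0 : ℝ), (((x : ℝ) * y - ω (Real.exp x) : ℝ) : EReal)

variable {N : ℕ}

/-- `ω(z) = ω(|z|)` with `|z| = ∑ⱼ |zⱼ|`, for `z ∈ ℂᴺ`. -/
def weightC (ω : ℝ → ℝ) (z : Fin N → ℂ) : ℝ := ω (∑ j, ‖z j‖)

/-- The inclusion `ℝᴺ ⊆ ℂᴺ`. -/
def toC (t : EuclideanSpace ℝ (Fin N)) : Fin N → ℂ := fun j => (t j : ℂ)

/-- The integrand `f(t) e^{-i⟨t,z⟩}`, with `⟨t,z⟩ = ∑ⱼ tⱼ zⱼ`. -/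
def laplaceIntegrand (f : EuclideanSpace ℝ (Fin N) → ℂ) (z : Fin N → ℂ)
    (t : EuclideanSpace ℝ (Fin N)) : ℂ :=
  f t * Complex.exp (-Complex.I * ∑ j, (t j : ℂ) * z j)

/-- The Fourier–Laplace transform `f̂(z) = ∫ f(t) e^{-i⟨t,z⟩} dt`. -/
def fourierLaplace (f : EuclideanSpace ℝ (Fin N) → ℂ) (z : Fin N → ℂ) : ℂ :=
  ∫ t, laplaceIntegrand f z t

/-- The supporting function `H_K(η) = sup_{x ∈ K} ⟨x,η⟩`. -/
def supportFun (K : Set (EuclideanSpace ℝ (Fin N))) (η : Fin N → ℝ) : ℝ :=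
  sSup ((fun x : EuclideanSpace ℝ (Fin N) => ∑ j, x j * η j) '' K)

/-- The partial derivative `∂g/∂xⱼ`. -/
def partialD (j : Fin N) (g : EuclideanSpace ℝ (Fin N) → ℂ) : EuclideanSpace ℝ (Fin N) → ℂ :=
  fun x => fderiv ℝ g x (EuclideanSpace.single j 1)

/-- The derivative `f^{(α)} = ∂₁^{α₁} ⋯ ∂_N^{α_N} f` for a multi-index `α`. -/
def multiD (α : Fin N → ℕ) (f : EuclideanSpace ℝ (Fin N) → ℂ) :
    EuclideanSpace ℝ (Fin N) → ℂ :=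
  (List.finRange N).foldr (fun j g => (partialD j)^[α j] g) f

/-- `𝒟(K)`: smooth functions on `ℝᴺ` with support in `K`. -/
def testFun (K : Set (EuclideanSpace ℝ (Fin N))) : Set (EuclideanSpace ℝ (Fin N) → ℂ) :=
  {f | ContDiff ℝ ((⊤ : ℕ∞) : WithTop ℕ∞) f ∧ tsupport f ⊆ K}

/-- `𝒟_λ(K)`: those `f ∈ 𝒟(K)` with `∫ |f̂(t)| e^{λ ω(t)} dt < ∞`. -/
def testFunLam (ω : ℝ → ℝ) (lam : ℝ) (K : Set (EuclideanSpace ℝ (Fin N))) :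
    Set (EuclideanSpace ℝ (Fin N) → ℂ) :=
  {f | f ∈ testFun K ∧
    ∫⁻ t, ‖fourierLaplace f (toC t)‖ₑ * ENNReal.ofReal (Real.exp (lam * weightC ω (toC t))) < ∞}

/-- `𝒟_(ω)(K)`, the projective limit of the spaces `𝒟_λ(K)` as `λ → ∞`; as a set it is their
intersection. -/
def beurlingTestFun (ω : ℝ → ℝ) (K : Set (EuclideanSpace ℝ (Fin N))) :
    Set (EuclideanSpace ℝ (Fin N) → ℂ) :=
  ⋂ lam ∈ Ioi (0 : ℝ), testFunLam ω lam K

/-- `sup_α sup_x |f^{(α)}(x)| e^{-k φ*(|α|/k)}`, with `e^{-∞} = 0`. -/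
def derivSup (ω : ℝ → ℝ) (k : ℕ) (f : EuclideanSpace ℝ (Fin N) → ℂ) : ℝ≥0∞ :=
  ⨆ (α : Fin N → ℕ) (x : EuclideanSpace ℝ (Fin N)),
    ‖multiD α f x‖ₑ *
      EReal.exp (-(((k : ℝ) : EReal) * youngConj ω (((∑ j, α j : ℕ) : ℝ) / (k : ℝ))))

end PaleyWienerBeurling

end

/-!
(1) ⇒ (2): by Fourier inversion `|g^{(α)}(x)|` is at most a constant times `∫ |t|^{|α|} |ĝ(t)| dt`,
and `|t|^n ≤ exp (k φ*(n / k)) exp (k ω(t))` for `|t| ≥ 1` by the definition of `φ*`.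

(2) ⇒ (3): integrating by parts `m` times in the direction of a largest coordinate of `z` bounds
`|z|^m |ĝ(z)|` by `exp (k φ*(m / k) + H_K(Im z))`. Since `φ` is convex, it has a subgradient at
`log |z|`; for `m` the integer part of `k` times this subgradient, `exp (k φ*(m / k)) |z|^{-m}` is
at most `|z| exp (-k ω(z))`. The factor `|z|` and the passage from the maximum norm to the sum norm
are absorbed by a larger `k`, because of (γ)' and (α).

(3) ⇒ (1): by (γ)' the factor `exp (-k ω)` beats every power of `1 + |z|`, so that `f` is smooth
after a change on a null set. The transform of `e^{n⟨t,η⟩} f` is a translate of `f̂` by `i n η`, so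
`|f(x)| e^{n⟨x,η⟩} ≤ B e^{n H_K(η)}` for every `n`; hence `f` vanishes outside every half-space
containing `K`.
-/

namespace PaleyWienerBeurling

open scoped FourierTransform

/-! ### Fourier inversion -/

section Inversion

variable {V E : Type*} [NormedAddCommGroup V] [InnerProductSpace ℝ V] [FiniteDimensional ℝ V]
  [MeasurableSpace V] [BorelSpace V] [NormedAddCommGroup E] [NormedSpace ℂ E] {f : V → E}

theorem continuous_fourier (hf : Integrable f) : Continuous (𝓕 f) :=
  VectorFourier.fourierIntegral_continuous Real.continuous_fourierChar
    (L := innerₗ V) continuous_inner hf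

theorem fourierInv_eq_fourier_comp_neg (f : V → E) : 𝓕⁻ f = 𝓕 f ∘ Neg.neg :=
  funext fun v => Real.fourierInv_eq_fourier_neg f v

theorem contDiff_fourierInv {n : ℕ∞}
    (hf : ∀ m : ℕ, m ≤ n → Integrable fun v => ‖v‖ ^ m * ‖f v‖) : ContDiff ℝ n (𝓕⁻ f) := by
  rw [fourierInv_eq_fourier_comp_neg]
  exact (Real.contDiff_fourier hf).comp contDiff_neg

theorem continuous_fourierInv (hf : Integrable f) : Continuous (𝓕⁻ f) := by
  rw [fourierInv_eq_fourier_comp_neg]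
  exact (continuous_fourier hf).comp continuous_neg

theorem norm_fourierInv_le_integral_norm (f : V → E) (v : V) : ‖𝓕⁻ f v‖ ≤ ∫ w, ‖f w‖ := by
  rw [Real.fourierInv_eq]
  simpa only [Circle.norm_smul] using
    norm_integral_le_integral_norm fun w => Real.fourierChar (inner ℝ w v) • f w

variable [CompleteSpace E]

theorem integral_fourier_smul_eq {g : V → ℂ} (hg : Integrable g) (hf : Integrable f) :
    ∫ v, 𝓕 g v • f v = ∫ v, g v • 𝓕 f v := by
  have h := VectorFourier.integral_fourierIntegral_smul_eq_flip (L := innerₗ V)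
    Real.continuous_fourierChar continuous_inner hg hf
  rwa [flip_innerₗ] at h

theorem integral_fourierInv_smul_eq {g : V → ℂ} (hg : Integrable g) (hf : Integrable f) :
    ∫ v, 𝓕⁻ g v • f v = ∫ v, g v • 𝓕⁻ f v := by
  have hint : Continuous fun p : V × V => (-innerₗ V) p.1 p.2 := continuous_inner.neg
  have hflip : (-innerₗ V).flip = -innerₗ V := by
    ext x y
    simp [real_inner_comm]
  have h := VectorFourier.integral_fourierIntegral_smul_eq_flip (L := -innerₗ V)
    Real.continuous_fourierChar hint hg hf
  rw [hflip] at h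
  exact h

/-- Both sides are tested against smooth functions, and inversion is applied to the test
function. -/
theorem ae_eq_fourierInv_fourier (hf : Integrable f) (hf' : Integrable (𝓕 f)) :
    f =ᵐ[volume] 𝓕⁻ (𝓕 f) := by
  refine ae_eq_of_integral_contDiff_smul_eq hf.locallyIntegrable
    (continuous_fourierInv hf').locallyIntegrable fun ψ hψ hψc => ?_
  have hψc' : HasCompactSupport fun v => (ψ v : ℂ) := hψc.comp_left Complex.ofReal_zero
  let Ψ : SchwartzMap V ℂ := hψc'.toSchwartzMap (Complex.ofRealCLM.contDiff.comp hψ)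
  calc ∫ v, Ψ v • f v = ∫ v, 𝓕 (𝓕⁻ Ψ) v • f v := by rw [FourierTransform.fourier_fourierInv_eq]
    _ = ∫ v, (𝓕⁻ Ψ) v • 𝓕 f v := integral_fourier_smul_eq (𝓕⁻ Ψ).integrable hf
    _ = ∫ v, Ψ v • 𝓕⁻ (𝓕 f) v := by
      rw [SchwartzMap.fourierInv_coe]
      exact integral_fourierInv_smul_eq Ψ.integrable hf'

theorem enorm_le_lintegral_enorm_fourier (hc : Continuous f) (hf : Integrable f) (v : V) :
    ‖f v‖ₑ ≤ ∫⁻ w, ‖𝓕 f w‖ₑ := by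
  rcases eq_top_or_lt_top (∫⁻ w, ‖𝓕 f w‖ₑ) with h | h
  · simp [h]
  have hf' : Integrable (𝓕 f) := ⟨(continuous_fourier hf).aestronglyMeasurable, h⟩
  have hinv : f v = ∫ w, Real.fourierChar (inner ℝ w v) • 𝓕 f w := by
    rw [← Real.fourierInv_eq, hc.fourierInv_fourier_eq hf hf']
  rw [hinv]
  refine (enorm_integral_le_lintegral_enorm _).trans_eq (lintegral_congr fun w => ?_)
  rw [← ofReal_norm, ← ofReal_norm, Circle.norm_smul]

end Inversion

section Haar

variable {E : Type*} [NormedAddCommGroup E] [NormedSpace ℝ E] [FiniteDimensional ℝ E]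
  [MeasurableSpace E] [BorelSpace E] (μ : Measure E) [μ.IsAddHaarMeasure]

theorem lintegral_comp_smul (F : E → ℝ≥0∞) {c : ℝ} (hc : c ≠ 0) :
    ∫⁻ x, F (c • x) ∂μ = ENNReal.ofReal |(c ^ Module.finrank ℝ E)⁻¹| * ∫⁻ x, F x ∂μ := by
  rw [← smul_eq_mul, ← lintegral_smul_measure, ← Measure.map_addHaar_smul μ hc]
  exact (lintegral_map_equiv F (Homeomorph.smulOfNeZero c hc).toMeasurableEquiv).symm

end Haar

theorem tsupport_subset_of_ae_halfSpace {E F : Type*} [AddCommGroup E] [TopologicalSpace E]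
    [IsTopologicalAddGroup E] [Module ℝ E] [ContinuousSMul ℝ E] [LocallyConvexSpace ℝ E]
    [MeasurableSpace E] [OpensMeasurableSpace E] {μ : Measure E} [μ.IsOpenPosMeasure]
    [TopologicalSpace F] [T2Space F] [Zero F] {K : Set E} (hKconv : Convex ℝ K)
    (hKclosed : IsClosed K) {g : E → F} (hg : Continuous g)
    (h : ∀ (ℓ : E →L[ℝ] ℝ) (u : ℝ), (∀ y ∈ K, ℓ y < u) → ∀ᵐ x ∂μ, u < ℓ x → g x = 0) :
    tsupport g ⊆ K := by
  refine closure_minimal (fun x hx => by_contra fun hxK => hx ?_) hKclosed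
  obtain ⟨ℓ, u, hKu, hux⟩ := geometric_hahn_banach_closed_point hKconv hKclosed hxK
  have hopen : IsOpen {y | u < ℓ y} := isOpen_lt continuous_const ℓ.continuous
  have hzero : g =ᵐ[μ.restrict {y | u < ℓ y}] fun _ => 0 :=
    (ae_restrict_iff' hopen.measurableSet).2 (h ℓ u hKu)
  exact Measure.eqOn_open_of_ae_eq hzero hopen hg.continuousOn continuousOn_const hux

theorem eq_zero_of_norm_mul_exp_le {E : Type*} [NormedAddCommGroup E] {v : E} {B a b : ℝ}
    (hab : b < a) (h : ∀ n : ℕ, ‖v‖ * Real.exp (n * a) ≤ B * Real.exp (n * b)) : v = 0 := by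
  have hle (n : ℕ) : ‖v‖ ≤ B * Real.exp (-(n * (a - b))) := by
    have hn := h n
    rw [← le_div_iff₀ (Real.exp_pos _), mul_div_assoc, ← Real.exp_sub] at hn
    exact hn.trans_eq (by ring_nf)
  have hlim : Filter.Tendsto (fun n : ℕ => B * Real.exp (-(n * (a - b))))
      Filter.atTop (nhds 0) := by
    simpa using (Real.tendsto_exp_neg_atTop_nhds_zero.comp
      (tendsto_natCast_atTop_atTop.atTop_mul_const (sub_pos.2 hab))).const_mul B
  exact norm_le_zero_iff.1 (ge_of_tendsto' hlim hle)

/-! ### Convexity and the Young conjugate -/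

theorem exists_subgradient {S : Set ℝ} {φ : ℝ → ℝ} {s : ℝ} (hφ : ConvexOn ℝ S φ)
    (hs : s ∈ interior S) : ∃ y, ∀ x ∈ S, φ s + y * (x - s) ≤ φ x := by
  refine ⟨derivWithin φ (Ioi s) s, fun x hx => ?_⟩
  rcases lt_trichotomy x s with hxs | rfl | hsx
  · have h := (hφ.slope_le_leftDeriv_of_mem_interior hx hs hxs).trans
      (hφ.leftDeriv_le_rightDeriv_of_mem_interior hs)
    rw [slope_def_field, div_le_iff₀ (sub_pos.2 hxs)] at h
    linarith
  · simp
  · have h := hφ.rightDeriv_le_slope_of_mem_interior hs hx hsx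
    rw [slope_def_field, le_div_iff₀ (sub_pos.2 hsx)] at h
    linarith

theorem exists_nonneg_subgradient {φ : ℝ → ℝ} {a s : ℝ} (hφ : ConvexOn ℝ (Ici a) φ)
    (hmono : MonotoneOn φ (Ici a)) (hs : a ≤ s) :
    ∃ y, 0 ≤ y ∧ ∀ x, a ≤ x → φ s + y * (x - s) ≤ φ x := by
  rcases hs.eq_or_lt with rfl | has
  · exact ⟨0, le_rfl, fun x hx => by simpa using hmono self_mem_Ici hx hx⟩
  obtain ⟨y, hy⟩ := exists_subgradient hφ (by rwa [interior_Ici])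
  refine ⟨y, ?_, hy⟩
  have hya := (hy a self_mem_Ici).trans (hmono self_mem_Ici hs hs)
  nlinarith


section YoungConj

variable {ω : ℝ → ℝ}

theorem le_youngConj (ω : ℝ → ℝ) (y : ℝ) {t : ℝ} (ht : 1 ≤ t) :
    ((Real.log t * y - ω t : ℝ) : EReal) ≤ youngConj ω y := by
  have h := le_iSup (fun x : Ici (0 : ℝ) => (((x : ℝ) * y - ω (Real.exp x) : ℝ) : EReal))
    ⟨Real.log t, Real.log_nonneg ht⟩
  rwa [Real.exp_log (by positivity)] at h

theorem youngConj_mono (ω : ℝ → ℝ) : Monotone (youngConj ω) := fun _ _ hy =>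
  iSup_mono fun x => EReal.coe_le_coe_iff.2 <| by gcongr; exact x.2

theorem youngConj_zero_le (hmono : MonotoneOn ω (Ici 0)) :
    youngConj ω 0 ≤ ((-ω 1 : ℝ) : EReal) := by
  refine iSup_le fun x => EReal.coe_le_coe_iff.2 ?_
  have h := hmono (mem_Ici.2 zero_le_one) (Real.exp_pos x).le (Real.one_le_exp x.2)
  linarith

theorem exists_youngConj_le (hmono : MonotoneOn ω (Ici 0))
    (hδ : ConvexOn ℝ (Ici 0) fun x => ω (Real.exp x)) {t : ℝ} (ht : 1 ≤ t) :
    ∃ y, 0 ≤ y ∧ youngConj ω y ≤ ((Real.log t * y - ω t : ℝ) : EReal) := by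
  have hφ : MonotoneOn (fun x => ω (Real.exp x)) (Ici 0) := fun x _ y _ hxy =>
    hmono (Real.exp_pos x).le (Real.exp_pos y).le (Real.exp_le_exp.2 hxy)
  obtain ⟨y, hy, hsub⟩ := exists_nonneg_subgradient hδ hφ (Real.log_nonneg ht)
  refine ⟨y, hy, iSup_le fun x => EReal.coe_le_coe_iff.2 ?_⟩
  have h := hsub x x.2
  rw [Real.exp_log (by positivity)] at h
  linarith

theorem exists_nat_youngConj_le (hmono : MonotoneOn ω (Ici 0))
    (hδ : ConvexOn ℝ (Ici 0) fun x => ω (Real.exp x)) {k : ℝ} (hk : 0 < k) {t : ℝ} (ht : 1 ≤ t) :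
    ∃ m : ℕ, youngConj ω (m / k) ≤ ((Real.log t * ((m + 1) / k) - ω t : ℝ) : EReal) := by
  obtain ⟨y, hy, hyt⟩ := exists_youngConj_le hmono hδ ht
  refine ⟨⌊k * y⌋₊, (youngConj_mono ω ?_).trans (hyt.trans (EReal.coe_le_coe_iff.2 ?_))⟩
  · rw [div_le_iff₀' hk]
    exact Nat.floor_le (by positivity)
  · gcongr
    · exact Real.log_nonneg ht
    · rw [le_div_iff₀' hk]
      exact (Nat.lt_floor_add_one _).le

theorem ofReal_pow_mul_exp_neg_youngConj_le (ω : ℝ → ℝ) {k : ℝ} (hk : 0 < k) (m : ℕ) {t : ℝ}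
    (ht : 1 ≤ t) :
    ENNReal.ofReal (t ^ m) * EReal.exp (-((k : EReal) * youngConj ω (m / k))) ≤
      ENNReal.ofReal (Real.exp (k * ω t)) := by
  have hle : ((k * (Real.log t * (m / k) - ω t) : ℝ) : EReal) ≤ k * youngConj ω (m / k) := by
    rw [EReal.coe_mul]
    exact mul_le_mul_of_nonneg_left (le_youngConj ω _ ht) (EReal.coe_nonneg.2 hk.le)
  have hexp : EReal.exp (-((k : EReal) * youngConj ω (m / k))) ≤
      ENNReal.ofReal (Real.exp (k * ω t - m * Real.log t)) := by
    rw [← EReal.exp_coe, EReal.exp_le_exp_iff, EReal.neg_le, ← EReal.coe_neg]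
    refine le_of_eq_of_le ?_ hle
    congr 1
    field_simp
    ring
  calc _ ≤ ENNReal.ofReal (t ^ m) * ENNReal.ofReal (Real.exp (k * ω t - m * Real.log t)) := by
        gcongr
    _ = ENNReal.ofReal (Real.exp (k * ω t)) := by
        rw [← ENNReal.ofReal_mul (by positivity), Real.exp_sub, Real.exp_nat_mul,
          Real.exp_log (by positivity), mul_div_cancel₀ _ (by positivity)]

theorem ofReal_pow_mul_exp_neg_youngConj_le_of_nonneg (hnonneg : ∀ t, 0 ≤ t → 0 ≤ ω t) {k : ℝ}
    (hk : 0 < k) (m : ℕ) {t : ℝ} (ht : 0 ≤ t) :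
    ENNReal.ofReal (t ^ m) * EReal.exp (-((k : EReal) * youngConj ω (m / k))) ≤
      ENNReal.ofReal (Real.exp (k * ω 1) * Real.exp (k * ω t)) := by
  have hmax : ω (max 1 t) ≤ ω 1 + ω t := by
    have h₁ := hnonneg 1 zero_le_one
    have ht := hnonneg t ht
    rcases max_choice 1 t with h | h <;> rw [h] <;> linarith
  calc _ ≤ ENNReal.ofReal (max 1 t ^ m) * EReal.exp (-((k : EReal) * youngConj ω (m / k))) := by
        gcongr
        exact le_max_right 1 t
    _ ≤ ENNReal.ofReal (Real.exp (k * ω (max 1 t))) :=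
        ofReal_pow_mul_exp_neg_youngConj_le ω hk m (le_max_left 1 t)
    _ ≤ _ := by
        rw [← Real.exp_add, ← mul_add]
        gcongr

end YoungConj

/-! ### Growth of weights -/

section Growth

variable {ω : ℝ → ℝ} {A a b t : ℝ}

theorem one_add_pow_le_exp (hb : 0 < b) (hlog : ∀ t, 0 ≤ t → a + b * Real.log (1 + t) ≤ ω t)
    (ht : 0 ≤ t) (n : ℕ) : (1 + t) ^ n ≤ Real.exp (n * ((ω t - a) / b)) := by
  rw [Real.exp_nat_mul]
  gcongr
  rw [← Real.log_le_iff_le_exp (by positivity), le_div_iff₀' hb]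
  linarith [hlog t ht]

theorem one_add_comp_two_pow_mul_le (hnonneg : ∀ t, 0 ≤ t → 0 ≤ ω t) (hA : 0 ≤ A)
    (hα : ∀ t, 0 ≤ t → ω (2 * t) ≤ A * (1 + ω t)) (n : ℕ) (ht : 0 ≤ t) :
    1 + ω (2 ^ n * t) ≤ (1 + A) ^ n * (1 + ω t) := by
  induction n with
  | zero => simp
  | succ n ih =>
    have hn : 0 ≤ 2 ^ n * t := by positivity
    calc 1 + ω (2 ^ (n + 1) * t) = 1 + ω (2 * (2 ^ n * t)) := by ring_nf
      _ ≤ (1 + A) * (1 + ω (2 ^ n * t)) := by linarith [hα _ hn, hnonneg _ hn]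
      _ ≤ (1 + A) * ((1 + A) ^ n * (1 + ω t)) := by gcongr
      _ = (1 + A) ^ (n + 1) * (1 + ω t) := by ring

theorem comp_natCast_mul_le (hnonneg : ∀ t, 0 ≤ t → 0 ≤ ω t) (hmono : MonotoneOn ω (Ici 0))
    (hA : 0 ≤ A) (hα : ∀ t, 0 ≤ t → ω (2 * t) ≤ A * (1 + ω t)) (n : ℕ) (ht : 0 ≤ t) :
    ω (n * t) ≤ (1 + A) ^ n * (1 + ω t) := by
  have hn : (n : ℝ) * t ≤ 2 ^ n * t := by
    gcongr
    exact_mod_cast Nat.lt_two_pow_self.le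
  have hle : ω (n * t) ≤ ω (2 ^ n * t) :=
    hmono (mem_Ici.2 (by positivity)) (mem_Ici.2 (by positivity)) hn
  linarith [one_add_comp_two_pow_mul_le hnonneg hA hα n ht]

end Growth

/-! ### The Fourier–Laplace transform -/

section FourierLaplace

variable {N : ℕ} {f g : EuclideanSpace ℝ (Fin N) → ℂ}

/-- The bilinear pairing `⟨t,z⟩ = ∑ⱼ tⱼ zⱼ` of `ℝᴺ` with `ℂᴺ`, as a real-linear map in `t`. It
makes the exponential in `laplaceIntegrand` available to the differential calculus. -/
noncomputable def pairing (z : Fin N → ℂ) : EuclideanSpace ℝ (Fin N) →L[ℝ] ℂ :=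
  ∑ j, (EuclideanSpace.proj j : EuclideanSpace ℝ (Fin N) →L[ℝ] ℝ).smulRight (z j)

theorem pairing_apply (z : Fin N → ℂ) (t : EuclideanSpace ℝ (Fin N)) :
    pairing z t = ∑ j, (t j : ℂ) * z j := by
  simp [pairing]

theorem pairing_single (z : Fin N → ℂ) (j : Fin N) :
    pairing z (EuclideanSpace.single j 1) = z j := by
  rw [pairing_apply, Finset.sum_eq_single j] <;> simp +contextual

theorem laplaceIntegrand_eq (f : EuclideanSpace ℝ (Fin N) → ℂ) (z : Fin N → ℂ)
    (t : EuclideanSpace ℝ (Fin N)) :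
    laplaceIntegrand f z t = f t * Complex.exp (-Complex.I * pairing z t) := by
  rw [laplaceIntegrand, pairing_apply]

theorem norm_laplaceIntegrand (f : EuclideanSpace ℝ (Fin N) → ℂ) (z : Fin N → ℂ)
    (t : EuclideanSpace ℝ (Fin N)) :
    ‖laplaceIntegrand f z t‖ = ‖f t‖ * Real.exp (∑ j, t j * (z j).im) := by
  rw [laplaceIntegrand, norm_mul, Complex.norm_exp]
  simp

theorem laplaceIntegrand_zero (f : EuclideanSpace ℝ (Fin N) → ℂ) : laplaceIntegrand f 0 = f := by
  funext t
  simp [laplaceIntegrand]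

theorem fourierLaplace_congr_ae (h : f =ᵐ[volume] g) (z : Fin N → ℂ) :
    fourierLaplace f z = fourierLaplace g z :=
  integral_congr_ae (h.mono fun t ht => by simp only [laplaceIntegrand, ht])

theorem fourier_laplaceIntegrand (f : EuclideanSpace ℝ (Fin N) → ℂ) (z : Fin N → ℂ)
    (w : EuclideanSpace ℝ (Fin N)) :
    𝓕 (laplaceIntegrand f z) w = fourierLaplace f (toC ((2 * Real.pi) • w) + z) := by
  have hexp (t : EuclideanSpace ℝ (Fin N)) : ((-2 * Real.pi * inner ℝ t w : ℝ) : ℂ) * Complex.I =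
      -Complex.I * ∑ j, (t j : ℂ) * toC ((2 * Real.pi) • w) j := by
    simp only [PiLp.inner_apply, toC, PiLp.smul_apply, smul_eq_mul, RCLike.inner_apply,
      conj_trivial]
    push_cast
    rw [Finset.mul_sum, Finset.sum_mul, Finset.mul_sum]
    exact Finset.sum_congr rfl fun j _ => by ring
  rw [Real.fourier_eq', fourierLaplace]
  congr 1 with t
  rw [hexp, smul_eq_mul, laplaceIntegrand, laplaceIntegrand, mul_left_comm, ← Complex.exp_add,
    ← mul_add, ← Finset.sum_add_distrib]
  simp only [Pi.add_apply, mul_add]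

theorem fourier_eq_fourierLaplace (f : EuclideanSpace ℝ (Fin N) → ℂ)
    (w : EuclideanSpace ℝ (Fin N)) :
    𝓕 f w = fourierLaplace f (toC ((2 * Real.pi) • w)) := by
  simpa only [laplaceIntegrand_zero, add_zero] using fourier_laplaceIntegrand f 0 w

theorem hasFDerivAt_exp_pairing (z : Fin N → ℂ) (t : EuclideanSpace ℝ (Fin N)) :
    HasFDerivAt (fun t => Complex.exp (-Complex.I * pairing z t))
      (Complex.exp (-Complex.I * pairing z t) • ((-Complex.I) • pairing z)) t :=
  ((pairing z).hasFDerivAt.const_mul (-Complex.I)).cexp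

theorem fourierLaplace_partialD (hg : Differentiable ℝ g) {z : Fin N → ℂ} {j : Fin N}
    (hi : Integrable (laplaceIntegrand g z))
    (hi' : Integrable (laplaceIntegrand (partialD j g) z)) :
    fourierLaplace (partialD j g) z = Complex.I * z j * fourierLaplace g z := by
  set e : EuclideanSpace ℝ (Fin N) → ℂ := fun t => Complex.exp (-Complex.I * pairing z t)
  have hder (t) : fderiv ℝ e t (EuclideanSpace.single j 1) = -(Complex.I * z j) * e t := by
    rw [(hasFDerivAt_exp_pairing z t).fderiv]
    simp only [smul_apply, pairing_single, smul_eq_mul, e]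
    ring
  have hge (h : EuclideanSpace ℝ (Fin N) → ℂ) : laplaceIntegrand h z = fun t => e t * h t :=
    funext fun t => (laplaceIntegrand_eq h z t).trans (mul_comm _ _)
  have hi'' : Integrable fun t => fderiv ℝ e t (EuclideanSpace.single j 1) * g t := by
    simpa only [hder, mul_assoc, hge] using hi.const_mul (-(Complex.I * z j))
  rw [hge] at hi hi'
  have hparts := integral_mul_fderiv_eq_neg_fderiv_mul_of_integrable (μ := volume)
    hi'' hi' hi (fun t _ => (hasFDerivAt_exp_pairing z t).differentiableAt) fun t _ => hg t
  calc fourierLaplace (partialD j g) z = ∫ t, e t * partialD j g t := by rw [fourierLaplace, hge]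
    _ = -∫ t, -(Complex.I * z j) * (e t * g t) := by
      simp only [partialD, hparts, hder, mul_assoc]
    _ = Complex.I * z j * fourierLaplace g z := by
      rw [integral_const_mul, neg_mul, neg_neg, fourierLaplace, hge]

end FourierLaplace

section SupportFun

variable {N : ℕ} {K : Set (EuclideanSpace ℝ (Fin N))}

theorem le_supportFun (hK : IsCompact K) {x : EuclideanSpace ℝ (Fin N)} (hx : x ∈ K)
    (η : Fin N → ℝ) : ∑ j, x j * η j ≤ supportFun K η :=
  le_csSup (hK.image (by fun_prop)).bddAbove (mem_image_of_mem _ hx)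

theorem supportFun_smul (K : Set (EuclideanSpace ℝ (Fin N))) {s : ℝ} (hs : 0 ≤ s)
    (η : Fin N → ℝ) : supportFun K (s • η) = s * supportFun K η := by
  have h (x : EuclideanSpace ℝ (Fin N)) : ∑ j, x j * (s • η) j = s • ∑ j, x j * η j := by
    simp only [Pi.smul_apply, smul_eq_mul, Finset.mul_sum, mul_left_comm]
  simp only [supportFun, h]
  rw [← smul_eq_mul, ← Real.sSup_smul_of_nonneg hs, ← image_smul, image_image]

end SupportFun

/-! ### Test functions -/

section TestFun

variable {N : ℕ} {K : Set (EuclideanSpace ℝ (Fin N))} {g : EuclideanSpace ℝ (Fin N) → ℂ}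

theorem hasCompactSupport_of_mem_testFun (hK : IsCompact K) (hg : g ∈ testFun K) :
    HasCompactSupport g :=
  hK.of_isClosed_subset (isClosed_tsupport g) hg.2

theorem partialD_mem_testFun (hg : g ∈ testFun K) (j : Fin N) : partialD j g ∈ testFun K := by
  refine ⟨(hg.1.fderiv_right (m := ((⊤ : ℕ∞) : WithTop ℕ∞)) (by simp)).clm_apply contDiff_const,
    Subset.trans (closure_mono fun x hx => ?_) ((tsupport_fderiv_subset ℝ (f := g)).trans hg.2)⟩
  exact fun h => hx (by simp [partialD, h])

theorem iterate_partialD_mem_testFun (hg : g ∈ testFun K) (j : Fin N) (n : ℕ) :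
    (partialD j)^[n] g ∈ testFun K :=
  Function.Iterate.rec (· ∈ testFun K) hg (fun _ h => partialD_mem_testFun h j) n

theorem foldr_iterate_partialD_mem_testFun (hg : g ∈ testFun K) (α : Fin N → ℕ)
    (l : List (Fin N)) : l.foldr (fun j g => (partialD j)^[α j] g) g ∈ testFun K := by
  induction l with
  | nil => exact hg
  | cons j l ih => exact iterate_partialD_mem_testFun ih j (α j)

theorem multiD_mem_testFun (hg : g ∈ testFun K) (α : Fin N → ℕ) : multiD α g ∈ testFun K :=
  foldr_iterate_partialD_mem_testFun hg α _

theorem multiD_zero (g : EuclideanSpace ℝ (Fin N) → ℂ) : multiD 0 g = g := by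
  simp only [multiD, Pi.zero_apply, Function.iterate_zero, id_eq]
  exact List.foldr_fixed _

theorem integrable_of_mem_testFun (hK : IsCompact K) (hg : g ∈ testFun K) : Integrable g :=
  hg.1.continuous.integrable_of_hasCompactSupport (hasCompactSupport_of_mem_testFun hK hg)

theorem integrable_laplaceIntegrand (hK : IsCompact K) (hg : g ∈ testFun K) (z : Fin N → ℂ) :
    Integrable (laplaceIntegrand g z) := by
  simp only [funext (laplaceIntegrand_eq g z)]
  exact (hg.1.continuous.mul (by fun_prop)).integrable_of_hasCompactSupport
    (hasCompactSupport_of_mem_testFun hK hg).mul_right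

theorem fourierLaplace_iterate_partialD (hK : IsCompact K) (hg : g ∈ testFun K) (j : Fin N)
    (n : ℕ) (z : Fin N → ℂ) :
    fourierLaplace ((partialD j)^[n] g) z = (Complex.I * z j) ^ n * fourierLaplace g z := by
  induction n with
  | zero => simp
  | succ n ih =>
    have hn := iterate_partialD_mem_testFun hg j n
    rw [Function.iterate_succ_apply', fourierLaplace_partialD (hn.1.differentiable (by simp))
      (integrable_laplaceIntegrand hK hn z)
      (integrable_laplaceIntegrand hK (partialD_mem_testFun hn j) z), ih]
    ring

theorem fourierLaplace_multiD (hK : IsCompact K) (hg : g ∈ testFun K) (α : Fin N → ℕ)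
    (z : Fin N → ℂ) :
    fourierLaplace (multiD α g) z = (∏ j, (Complex.I * z j) ^ α j) * fourierLaplace g z := by
  simp only [Fin.prod_univ_def, multiD]
  induction List.finRange N with
  | nil => simp
  | cons j l ih =>
    rw [List.foldr_cons, fourierLaplace_iterate_partialD hK
      (foldr_iterate_partialD_mem_testFun hg α l), ih, List.map_cons, List.prod_cons, mul_assoc]

theorem norm_fourierLaplace_multiD (hK : IsCompact K) (hg : g ∈ testFun K) (α : Fin N → ℕ)
    (z : Fin N → ℂ) :
    ‖fourierLaplace (multiD α g) z‖ = (∏ j, ‖z j‖ ^ α j) * ‖fourierLaplace g z‖ := by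
  simp [fourierLaplace_multiD hK hg]

theorem norm_fourierLaplace_le (hK : IsCompact K) (hgK : tsupport g ⊆ K) {M : ℝ}
    (hM : ∀ x, ‖g x‖ ≤ M) (z : Fin N → ℂ) :
    ‖fourierLaplace g z‖ ≤ volume.real K * M * Real.exp (supportFun K fun j => (z j).im) := by
  set E := M * Real.exp (supportFun K fun j => (z j).im)
  have hle (t) : ‖laplaceIntegrand g z t‖ ≤ K.indicator (fun _ => E) t := by
    rw [norm_laplaceIntegrand]
    by_cases ht : t ∈ K
    · have hM₀ := (norm_nonneg _).trans (hM t)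
      rw [indicator_of_mem ht]
      exact mul_le_mul (hM t) (Real.exp_le_exp.2 (le_supportFun hK ht _)) (Real.exp_pos _).le hM₀
    · rw [image_eq_zero_of_notMem_tsupport fun h => ht (hgK h)]
      simp [indicator_of_notMem ht]
  calc ‖fourierLaplace g z‖ ≤ ∫ t, K.indicator (fun _ => E) t :=
        norm_integral_le_of_norm_le ((integrable_indicator_iff hK.measurableSet).2
          (integrableOn_const hK.measure_lt_top.ne)) (.of_forall hle)
    _ = _ := by rw [integral_indicator_const _ hK.measurableSet, smul_eq_mul, mul_assoc]

theorem prod_norm_pow_mul_norm_fourierLaplace_le (hK : IsCompact K) (hg : g ∈ testFun K)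
    {α : Fin N → ℕ} {M : ℝ} (hM : ∀ x, ‖multiD α g x‖ ≤ M) (z : Fin N → ℂ) :
    (∏ j, ‖z j‖ ^ α j) * ‖fourierLaplace g z‖ ≤
      volume.real K * M * Real.exp (supportFun K fun j => (z j).im) := by
  rw [← norm_fourierLaplace_multiD hK hg]
  exact norm_fourierLaplace_le hK (multiD_mem_testFun hg α).2 hM z

end TestFun

/-! ### Derivative bounds -/

section DerivBounds

variable {N : ℕ} {ω : ℝ → ℝ} {K : Set (EuclideanSpace ℝ (Fin N))}
  {g : EuclideanSpace ℝ (Fin N) → ℂ}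

theorem prod_norm_pow_le (z : Fin N → ℂ) (α : Fin N → ℕ) :
    ∏ j, ‖z j‖ ^ α j ≤ (∑ j, ‖z j‖) ^ ∑ j, α j := by
  rw [← Finset.prod_pow_eq_pow_sum]
  gcongr with j
  exact Finset.single_le_sum (f := fun j => ‖z j‖) (fun _ _ => norm_nonneg _) (Finset.mem_univ j)

theorem enorm_fourierLaplace_multiD_mul_le (hnonneg : ∀ t, 0 ≤ t → 0 ≤ ω t) (hK : IsCompact K)
    (hg : g ∈ testFun K) {k : ℝ} (hk : 0 < k) (α : Fin N → ℕ) (z : Fin N → ℂ) :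
    ‖fourierLaplace (multiD α g) z‖ₑ *
        EReal.exp (-((k : EReal) * youngConj ω (((∑ j, α j : ℕ) : ℝ) / k))) ≤
      ENNReal.ofReal (Real.exp (k * ω 1)) *
        (‖fourierLaplace g z‖ₑ * ENNReal.ofReal (Real.exp (k * weightC ω z))) := by
  set e := EReal.exp (-((k : EReal) * youngConj ω (((∑ j, α j : ℕ) : ℝ) / k)))
  have hsum : 0 ≤ ∑ j, ‖z j‖ := Finset.sum_nonneg fun _ _ => norm_nonneg _
  calc ‖fourierLaplace (multiD α g) z‖ₑ * e
      = ENNReal.ofReal (∏ j, ‖z j‖ ^ α j) * e * ‖fourierLaplace g z‖ₑ := by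
        rw [← ofReal_norm, norm_fourierLaplace_multiD hK hg, ENNReal.ofReal_mul (by positivity),
          ofReal_norm, mul_right_comm]
    _ ≤ ENNReal.ofReal ((∑ j, ‖z j‖) ^ ∑ j, α j) * e * ‖fourierLaplace g z‖ₑ := by
        gcongr
        exact prod_norm_pow_le z α
    _ ≤ ENNReal.ofReal (Real.exp (k * ω 1) * Real.exp (k * weightC ω z)) *
          ‖fourierLaplace g z‖ₑ := by
        gcongr
        exact ofReal_pow_mul_exp_neg_youngConj_le_of_nonneg hnonneg hk _ hsum
    _ = _ := by
        rw [ENNReal.ofReal_mul (by positivity), mul_assoc, mul_comm ‖fourierLaplace g z‖ₑ]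

theorem enorm_le_lintegral_enorm_fourierLaplace (hK : IsCompact K) (hg : g ∈ testFun K)
    (x : EuclideanSpace ℝ (Fin N)) :
    ‖g x‖ₑ ≤ ∫⁻ w, ‖fourierLaplace g (toC ((2 * Real.pi) • w))‖ₑ := by
  simpa only [fourier_eq_fourierLaplace] using
    enorm_le_lintegral_enorm_fourier hg.1.continuous (integrable_of_mem_testFun hK hg) x

theorem derivSup_lt_top (hnonneg : ∀ t, 0 ≤ t → 0 ≤ ω t) (hK : IsCompact K) {k : ℕ} (hk : 1 ≤ k)
    (hg : g ∈ testFunLam ω k K) : derivSup ω k g < ∞ := by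
  have hk₀ : (0 : ℝ) < k := by exact_mod_cast hk
  set G : EuclideanSpace ℝ (Fin N) → ℝ≥0∞ := fun t => ENNReal.ofReal (Real.exp (k * ω 1)) *
    (‖fourierLaplace g (toC t)‖ₑ * ENNReal.ofReal (Real.exp (k * weightC ω (toC t))))
  have hG : ∫⁻ w, G ((2 * Real.pi) • w) < ∞ := by
    rw [lintegral_comp_smul volume G (by positivity),
      lintegral_const_mul' _ _ ENNReal.ofReal_ne_top]
    exact ENNReal.mul_lt_top ENNReal.ofReal_lt_top
      (ENNReal.mul_lt_top ENNReal.ofReal_lt_top hg.2)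
  refine (iSup₂_le fun α x => ?_).trans_lt hG
  set e := EReal.exp (-(((k : ℝ) : EReal) * youngConj ω (((∑ j, α j : ℕ) : ℝ) / (k : ℝ))))
  calc ‖multiD α g x‖ₑ * e
      ≤ (∫⁻ w, ‖fourierLaplace (multiD α g) (toC ((2 * Real.pi) • w))‖ₑ) * e := by
        gcongr
        exact enorm_le_lintegral_enorm_fourierLaplace hK (multiD_mem_testFun hg.1 α) x
    _ ≤ ∫⁻ w, ‖fourierLaplace (multiD α g) (toC ((2 * Real.pi) • w))‖ₑ * e :=
        lintegral_mul_const_le _ _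
    _ ≤ ∫⁻ w, G ((2 * Real.pi) • w) :=
        lintegral_mono fun w => enorm_fourierLaplace_multiD_mul_le hnonneg hK hg.1 hk₀ α _

theorem norm_multiD_le_of_youngConj_le {k : ℕ} (h : derivSup ω k g < ∞) {α : Fin N → ℕ} {c : ℝ}
    (hc : youngConj ω (((∑ j, α j : ℕ) : ℝ) / (k : ℝ)) ≤ (c : EReal))
    (x : EuclideanSpace ℝ (Fin N)) :
    ‖multiD α g x‖ ≤ (derivSup ω k g).toReal * Real.exp (k * c) := by
  have hexp : ENNReal.ofReal (Real.exp (-(k * c))) ≤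
      EReal.exp (-(((k : ℝ) : EReal) * youngConj ω (((∑ j, α j : ℕ) : ℝ) / (k : ℝ)))) := by
    rw [← EReal.exp_coe, EReal.exp_le_exp_iff, EReal.coe_neg, EReal.neg_le_neg_iff, EReal.coe_mul]
    exact mul_le_mul_of_nonneg_left hc (EReal.coe_nonneg.2 k.cast_nonneg)
  have hle : ‖multiD α g x‖ₑ * ENNReal.ofReal (Real.exp (-(k * c))) ≤ derivSup ω k g :=
    (mul_le_mul_right hexp _).trans
      (le_iSup₂ (f := fun (α : Fin N → ℕ) (x : EuclideanSpace ℝ (Fin N)) => ‖multiD α g x‖ₑ *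
        EReal.exp (-(((k : ℝ) : EReal) * youngConj ω (((∑ j, α j : ℕ) : ℝ) / (k : ℝ))))) α x)
  have hreal := ENNReal.toReal_mono h.ne hle
  rwa [ENNReal.toReal_mul, toReal_enorm, ENNReal.toReal_ofReal (Real.exp_pos _).le, Real.exp_neg,
    ← div_eq_mul_inv, div_le_iff₀ (Real.exp_pos _)] at hreal

theorem norm_fourierLaplace_le_of_norm_le_one (hmono : MonotoneOn ω (Ici 0)) (hK : IsCompact K)
    (hg : g ∈ testFun K) {k : ℕ} (hd : derivSup ω k g < ∞) {z : Fin N → ℂ} (hz : ‖z‖ ≤ 1) :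
    ‖fourierLaplace g z‖ ≤ volume.real K *
      ((derivSup ω k g).toReal * Real.exp (-(k * ω ‖z‖))) *
        Real.exp (supportFun K fun j => (z j).im) := by
  refine norm_fourierLaplace_le hK hg.2 (fun x => ?_) z
  have hω : ω ‖z‖ ≤ ω 1 := hmono (norm_nonneg z) (mem_Ici.2 zero_le_one) hz
  have hc : youngConj ω (((∑ j, (0 : Fin N → ℕ) j : ℕ) : ℝ) / (k : ℝ)) ≤
      ((-ω ‖z‖ : ℝ) : EReal) := by
    simpa using (youngConj_zero_le hmono).trans (EReal.coe_le_coe_iff.2 (neg_le_neg hω))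
  simpa [multiD_zero] using norm_multiD_le_of_youngConj_le hd hc x

theorem norm_fourierLaplace_le_of_one_le_norm (hmono : MonotoneOn ω (Ici 0))
    (hδ : ConvexOn ℝ (Ici 0) fun x => ω (Real.exp x)) (hK : IsCompact K) (hg : g ∈ testFun K)
    {k : ℕ} (hk : 1 ≤ k) (hd : derivSup ω k g < ∞) {z : Fin N → ℂ} (hz : 1 ≤ ‖z‖) :
    ‖fourierLaplace g z‖ ≤ volume.real K *
      ((derivSup ω k g).toReal * (‖z‖ * Real.exp (-(k * ω ‖z‖)))) *
        Real.exp (supportFun K fun j => (z j).im) := by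
  have hk₀ : (0 : ℝ) < k := by exact_mod_cast hk
  have hz₀ : 0 < ‖z‖ := by positivity
  obtain ⟨j, hj⟩ : ∃ j, ‖z‖ ≤ ‖z j‖ := by
    by_contra! h
    exact lt_irrefl _ ((pi_norm_lt_iff hz₀).2 h)
  obtain ⟨m, hm⟩ := exists_nat_youngConj_le hmono hδ hk₀ hz
  set D := (derivSup ω k g).toReal
  set H := supportFun K fun j => (z j).im
  have hexp : Real.exp (k * (Real.log ‖z‖ * ((m + 1) / k) - ω ‖z‖)) =
      ‖z‖ ^ m * (‖z‖ * Real.exp (-(k * ω ‖z‖))) := by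
    rw [← mul_assoc, ← pow_succ, ← Real.exp_log (pow_pos hz₀ (m + 1)), ← Real.exp_add,
      Real.log_pow]
    congr 1
    push_cast
    field_simp
    ring
  have hderiv (x) : ‖multiD (Pi.single j m) g x‖ ≤
      D * (‖z‖ ^ m * (‖z‖ * Real.exp (-(k * ω ‖z‖)))) := by
    rw [← hexp]
    exact norm_multiD_le_of_youngConj_le hd (by simpa using hm) x
  have hprod : ∏ i, ‖z i‖ ^ (Pi.single j m : Fin N → ℕ) i = ‖z j‖ ^ m := by
    rw [Finset.prod_eq_single j (fun i _ hi => by simp [hi]) (by simp), Pi.single_eq_same]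
  refine le_of_mul_le_mul_left ?_ (pow_pos hz₀ m)
  calc ‖z‖ ^ m * ‖fourierLaplace g z‖ ≤ ‖z j‖ ^ m * ‖fourierLaplace g z‖ := by gcongr
    _ ≤ volume.real K * (D * (‖z‖ ^ m * (‖z‖ * Real.exp (-(k * ω ‖z‖))))) * Real.exp H := by
        rw [← hprod]
        exact prod_norm_pow_mul_norm_fourierLaplace_le hK hg hderiv z
    _ = _ := by ring

theorem norm_fourierLaplace_le_of_derivSup_lt_top (hmono : MonotoneOn ω (Ici 0))
    (hδ : ConvexOn ℝ (Ici 0) fun x => ω (Real.exp x)) (hK : IsCompact K) (hg : g ∈ testFun K)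
    {k : ℕ} (hk : 1 ≤ k) (hd : derivSup ω k g < ∞) (z : Fin N → ℂ) :
    ‖fourierLaplace g z‖ ≤ volume.real K *
      ((derivSup ω k g).toReal * ((1 + ‖z‖) * Real.exp (-(k * ω ‖z‖)))) *
        Real.exp (supportFun K fun j => (z j).im) := by
  have hz₀ := norm_nonneg z
  rcases le_total ‖z‖ 1 with hz | hz
  · refine (norm_fourierLaplace_le_of_norm_le_one hmono hK hg hd hz).trans ?_
    gcongr
    exact le_mul_of_one_le_left (Real.exp_pos _).le (by linarith)
  · refine (norm_fourierLaplace_le_of_one_le_norm hmono hδ hK hg hk hd hz).trans ?_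
    gcongr
    linarith

end DerivBounds

/-! ### Exponential bounds on the transform -/

section PaleyWienerBound

variable {N : ℕ} {ω : ℝ → ℝ} {A a b : ℝ} {K : Set (EuclideanSpace ℝ (Fin N))}
  {f g : EuclideanSpace ℝ (Fin N) → ℂ}

/-- The growth condition `|f̂(z)| ≤ C exp (H_K(Im z) - l ω(z))` on `ℂᴺ` for a single exponent `l`;
condition (3) of the theorem is its validity for `l = 1, 2, …`. -/
def PaleyWienerBound (ω : ℝ → ℝ) (K : Set (EuclideanSpace ℝ (Fin N))) (l : ℝ)
    (f : EuclideanSpace ℝ (Fin N) → ℂ) : Prop :=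
  ∃ C : ℝ, 0 < C ∧ ∀ z : Fin N → ℂ, ‖fourierLaplace f z‖ ≤
    C * Real.exp (supportFun K (fun j => (z j).im) - l * weightC ω z)

theorem weightC_nonneg (hnonneg : ∀ t, 0 ≤ t → 0 ≤ ω t) (z : Fin N → ℂ) : 0 ≤ weightC ω z :=
  hnonneg _ (Finset.sum_nonneg fun _ _ => norm_nonneg _)

theorem PaleyWienerBound.mono (hnonneg : ∀ t, 0 ≤ t → 0 ≤ ω t) {l l' : ℝ} (hl : l ≤ l')
    (h : PaleyWienerBound ω K l' f) : PaleyWienerBound ω K l f := by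
  obtain ⟨C, hC, hb⟩ := h
  refine ⟨C, hC, fun z => (hb z).trans ?_⟩
  have hw := weightC_nonneg hnonneg z
  gcongr

theorem PaleyWienerBound.congr_ae {l : ℝ} (h : PaleyWienerBound ω K l g) (hfg : f =ᵐ[volume] g) :
    PaleyWienerBound ω K l f := by
  simpa only [PaleyWienerBound, fourierLaplace_congr_ae hfg] using h

theorem weightC_le (hnonneg : ∀ t, 0 ≤ t → 0 ≤ ω t) (hmono : MonotoneOn ω (Ici 0)) (hA : 0 ≤ A)
    (hα : ∀ t, 0 ≤ t → ω (2 * t) ≤ A * (1 + ω t)) (z : Fin N → ℂ) :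
    weightC ω z ≤ (1 + A) ^ N * (1 + ω ‖z‖) := by
  have hsum : ∑ j, ‖z j‖ ≤ N * ‖z‖ := by simpa using Pi.sum_norm_apply_le_norm z
  refine (hmono ?_ ?_ hsum).trans (comp_natCast_mul_le hnonneg hmono hA hα N (norm_nonneg z))
  · exact Finset.sum_nonneg fun _ _ => norm_nonneg _
  · exact mem_Ici.2 (by positivity)

theorem one_add_norm_mul_exp_neg_le (hnonneg : ∀ t, 0 ≤ t → 0 ≤ ω t)
    (hmono : MonotoneOn ω (Ici 0)) (hA : 0 ≤ A) (hα : ∀ t, 0 ≤ t → ω (2 * t) ≤ A * (1 + ω t))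
    (hb : 0 < b) (hlog : ∀ t, 0 ≤ t → a + b * Real.log (1 + t) ≤ ω t) {k l : ℝ} (hk : 0 ≤ k)
    (hl : k * (1 + A) ^ N + 1 / b ≤ l) (z : Fin N → ℂ) :
    (1 + ‖z‖) * Real.exp (-(l * ω ‖z‖)) ≤
      Real.exp (k * (1 + A) ^ N - a / b) * Real.exp (-(k * weightC ω z)) := by
  have hz := norm_nonneg z
  have hpow : 1 + ‖z‖ ≤ Real.exp ((ω ‖z‖ - a) / b) := by
    simpa using one_add_pow_le_exp hb hlog hz 1
  have hw := mul_le_mul_of_nonneg_left (weightC_le hnonneg hmono hA hα z) hk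
  have hlω := mul_le_mul_of_nonneg_right hl (hnonneg _ hz)
  have hdiv : (ω ‖z‖ - a) / b = 1 / b * ω ‖z‖ - a / b := by ring
  calc (1 + ‖z‖) * Real.exp (-(l * ω ‖z‖))
      ≤ Real.exp ((ω ‖z‖ - a) / b) * Real.exp (-(l * ω ‖z‖)) := by gcongr
    _ ≤ _ := by
        rw [← Real.exp_add, ← Real.exp_add, Real.exp_le_exp]
        linarith

theorem paleyWienerBound_of_derivSup_lt_top (hnonneg : ∀ t, 0 ≤ t → 0 ≤ ω t)
    (hmono : MonotoneOn ω (Ici 0)) (hA : 0 ≤ A) (hα : ∀ t, 0 ≤ t → ω (2 * t) ≤ A * (1 + ω t))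
    (hb : 0 < b) (hlog : ∀ t, 0 ≤ t → a + b * Real.log (1 + t) ≤ ω t)
    (hδ : ConvexOn ℝ (Ici 0) fun x => ω (Real.exp x)) (hK : IsCompact K) (hg : g ∈ testFun K)
    (hd : ∀ k : ℕ, 1 ≤ k → derivSup ω k g < ∞) {k : ℝ} (hk : 0 ≤ k) :
    PaleyWienerBound ω K k g := by
  obtain ⟨l, hl⟩ := exists_nat_ge (k * (1 + A) ^ N + 1 / b)
  have hl₁ : 1 ≤ l := by
    have hl₀ : (0 : ℝ) < l := lt_of_lt_of_le (by positivity) hl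
    exact_mod_cast hl₀
  set D := (derivSup ω l g).toReal
  set M := Real.exp (k * (1 + A) ^ N - a / b)
  refine ⟨volume.real K * (D * M) + 1, by positivity, fun z => ?_⟩
  set H := supportFun K fun j => (z j).im
  calc ‖fourierLaplace g z‖
      ≤ volume.real K * (D * ((1 + ‖z‖) * Real.exp (-(l * ω ‖z‖)))) * Real.exp H :=
        norm_fourierLaplace_le_of_derivSup_lt_top hmono hδ hK hg hl₁ (hd l hl₁) z
    _ ≤ volume.real K * (D * (M * Real.exp (-(k * weightC ω z)))) * Real.exp H := by
        gcongr ?_ * (_ * ?_) * _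
        exact one_add_norm_mul_exp_neg_le hnonneg hmono hA hα hb hlog hk hl z
    _ = volume.real K * (D * M) * Real.exp (H - k * weightC ω z) := by
        rw [sub_eq_neg_add, Real.exp_add]
        ring
    _ ≤ (volume.real K * (D * M) + 1) * Real.exp (H - k * weightC ω z) := by
        gcongr
        linarith

theorem PaleyWienerBound.exists_one_add_sum_norm_pow_mul_le (hb : 0 < b)
    (hlog : ∀ t, 0 ≤ t → a + b * Real.log (1 + t) ≤ ω t) {l : ℝ} {n : ℕ}
    (h : PaleyWienerBound ω K (l + n / b) f) :
    ∃ C : ℝ, ∀ z : Fin N → ℂ, (1 + ∑ j, ‖z j‖) ^ n *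
      (‖fourierLaplace f z‖ * Real.exp (l * weightC ω z)) ≤
        C * Real.exp (supportFun K fun j => (z j).im) := by
  obtain ⟨C, -, hbound⟩ := h
  refine ⟨C * Real.exp (-(n * (a / b))), fun z => ?_⟩
  set H := supportFun K fun j => (z j).im
  have hpow : (1 + ∑ j, ‖z j‖) ^ n ≤ Real.exp (n * ((weightC ω z - a) / b)) :=
    one_add_pow_le_exp hb hlog (Finset.sum_nonneg fun _ _ => norm_nonneg _) n
  calc (1 + ∑ j, ‖z j‖) ^ n * (‖fourierLaplace f z‖ * Real.exp (l * weightC ω z))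
      ≤ Real.exp (n * ((weightC ω z - a) / b)) *
          (C * Real.exp (H - (l + n / b) * weightC ω z) * Real.exp (l * weightC ω z)) := by
        gcongr
        exact hbound z
    _ = C * (Real.exp (n * ((weightC ω z - a) / b)) * Real.exp (H - (l + n / b) * weightC ω z) *
          Real.exp (l * weightC ω z)) := by ring
    _ = C * Real.exp (-(n * (a / b))) * Real.exp H := by
        rw [← Real.exp_add, ← Real.exp_add, mul_assoc, ← Real.exp_add]
        ring_nf

end PaleyWienerBound

/-! ### Rapidly decreasing transforms -/

section RapidDecay

theorem norm_le_sum_norm {𝕜 ι : Type*} [RCLike 𝕜] [Fintype ι] (x : EuclideanSpace 𝕜 ι) :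
    ‖x‖ ≤ ∑ j, ‖x j‖ := by
  rw [EuclideanSpace.norm_eq, Real.sqrt_le_iff]
  exact ⟨Finset.sum_nonneg fun _ _ => norm_nonneg _,
    Finset.sum_sq_le_sq_sum_of_nonneg fun _ _ => norm_nonneg _⟩

theorem lintegral_ofReal_lt_top_of_one_add_norm_pow_mul_le {E : Type*} [NormedAddCommGroup E]
    [MeasurableSpace E] {μ : Measure E} [μ.HasTemperateGrowth] {G : E → ℝ} {C : ℝ}
    (h : ∀ t, (1 + ‖t‖) ^ μ.integrablePower * G t ≤ C) : ∫⁻ t, ENNReal.ofReal (G t) ∂μ < ∞ := by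
  have hle (t) : G t ≤ C * (1 + ‖t‖) ^ (-(μ.integrablePower : ℝ)) := by
    rw [Real.rpow_neg (by positivity), Real.rpow_natCast, ← div_eq_mul_inv,
      le_div_iff₀' (by positivity)]
    exact h t
  exact (lintegral_mono fun t => ENNReal.ofReal_le_ofReal (hle t)).trans_lt
    (Measure.integrable_pow_neg_integrablePower μ |>.const_mul C).lintegral_lt_top

variable {N : ℕ} {K : Set (EuclideanSpace ℝ (Fin N))} {f : EuclideanSpace ℝ (Fin N) → ℂ}

/-- The point `iη` of `ℂᴺ`. Multiplying `f` by `e^{⟨t,η⟩}` translates the transform by `iη`. -/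
def imagC (η : Fin N → ℝ) : Fin N → ℂ := fun j => (η j : ℂ) * Complex.I

theorem imagC_zero : imagC (0 : Fin N → ℝ) = 0 := by
  funext j
  simp [imagC]

theorem norm_laplaceIntegrand_imagC (f : EuclideanSpace ℝ (Fin N) → ℂ) (η : Fin N → ℝ)
    (t : EuclideanSpace ℝ (Fin N)) :
    ‖laplaceIntegrand f (imagC η) t‖ = ‖f t‖ * Real.exp (∑ j, t j * η j) := by
  simp [norm_laplaceIntegrand, imagC]

theorem norm_le_sum_norm_toC_add_imagC (t : EuclideanSpace ℝ (Fin N)) (η : Fin N → ℝ) :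
    ‖t‖ ≤ ∑ j, ‖(toC t + imagC η) j‖ :=
  (norm_le_sum_norm t).trans <| Finset.sum_le_sum fun j _ => by
    simpa [toC, imagC] using Complex.abs_re_le_norm ((toC t + imagC η) j)

/-- The growth condition of the classical Paley–Wiener theorem for smooth functions:
`(1 + |z|)ⁿ |f̂(z)| ≤ C exp (H_K(Im z))` on `ℂᴺ` for every `n`, with `|z| = ∑ⱼ |zⱼ|`. -/
def PaleyWienerDecay (K : Set (EuclideanSpace ℝ (Fin N)))
    (f : EuclideanSpace ℝ (Fin N) → ℂ) : Prop :=
  ∀ n : ℕ, ∃ C : ℝ, ∀ z : Fin N → ℂ, (1 + ∑ j, ‖z j‖) ^ n * ‖fourierLaplace f z‖ ≤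
    C * Real.exp (supportFun K fun j => (z j).im)

namespace PaleyWienerDecay

theorem exists_norm_pow_mul_norm_fourier_le (h : PaleyWienerDecay K f) (n : ℕ) :
    ∃ C : ℝ, ∀ (η : Fin N → ℝ) (w : EuclideanSpace ℝ (Fin N)),
      ‖w‖ ^ n * ‖𝓕 (laplaceIntegrand f (imagC η)) w‖ ≤ C * Real.exp (supportFun K η) := by
  obtain ⟨C, hC⟩ := h n
  refine ⟨C, fun η w => ?_⟩
  set z := toC ((2 * Real.pi) • w) + imagC η
  have hz : (1 + ∑ j, ‖z j‖) ^ n * ‖fourierLaplace f z‖ ≤ C * Real.exp (supportFun K η) := by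
    simpa [z, toC, imagC] using hC z
  have hw : ‖w‖ ≤ 1 + ∑ j, ‖z j‖ := calc
    ‖w‖ ≤ ‖(2 * Real.pi) • w‖ := by
      rw [norm_smul, Real.norm_of_nonneg (by positivity)]
      exact le_mul_of_one_le_left (norm_nonneg w) (by linarith [Real.pi_gt_three])
    _ ≤ ∑ j, ‖z j‖ := norm_le_sum_norm_toC_add_imagC _ η
    _ ≤ 1 + ∑ j, ‖z j‖ := le_add_of_nonneg_left zero_le_one
  rw [fourier_laplaceIntegrand]
  refine le_trans ?_ hz
  gcongr

theorem integrable_norm_pow_mul_norm_fourier (h : PaleyWienerDecay K f) {η : Fin N → ℝ}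
    (hi : Integrable (laplaceIntegrand f (imagC η))) (n : ℕ) :
    Integrable fun w => ‖w‖ ^ n * ‖𝓕 (laplaceIntegrand f (imagC η)) w‖ := by
  obtain ⟨C₀, h₀⟩ := h.exists_norm_pow_mul_norm_fourier_le 0
  obtain ⟨C₁, h₁⟩ := h.exists_norm_pow_mul_norm_fourier_le
    (n + (volume : Measure (EuclideanSpace ℝ (Fin N))).integrablePower)
  exact integrable_of_le_of_pow_mul_le (fun w => by simpa using h₀ η w) (h₁ η)
    (continuous_fourier hi).aestronglyMeasurable

theorem integrable_fourier (h : PaleyWienerDecay K f) {η : Fin N → ℝ}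
    (hi : Integrable (laplaceIntegrand f (imagC η))) :
    Integrable (𝓕 (laplaceIntegrand f (imagC η))) := by
  rw [← integrable_norm_iff (continuous_fourier hi).aestronglyMeasurable]
  simpa using h.integrable_norm_pow_mul_norm_fourier hi 0

theorem exists_integral_norm_fourier_le (h : PaleyWienerDecay K f) :
    ∃ B : ℝ, ∀ η : Fin N → ℝ,
      ∫ w, ‖𝓕 (laplaceIntegrand f (imagC η)) w‖ ≤ B * Real.exp (supportFun K η) := by
  set p := (volume : Measure (EuclideanSpace ℝ (Fin N))).integrablePower
  obtain ⟨C₀, h₀⟩ := h.exists_norm_pow_mul_norm_fourier_le 0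
  obtain ⟨C₁, h₁⟩ := h.exists_norm_pow_mul_norm_fourier_le p
  refine ⟨2 ^ p * (∫ w : EuclideanSpace ℝ (Fin N), (1 + ‖w‖) ^ (-(p : ℝ))) * (C₀ + C₁),
    fun η => ?_⟩
  have hle := integral_pow_mul_le_of_le_of_pow_mul_le (μ := volume) (k := 0)
    (f := 𝓕 (laplaceIntegrand f (imagC η))) (fun w => by simpa using h₀ η w)
    (fun w => by simpa using h₁ η w)
  simpa only [pow_zero, one_mul, ← add_mul, mul_assoc] using hle

theorem exists_ae_norm_mul_exp_le (h : PaleyWienerDecay K f)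
    (hi : ∀ z, Integrable (laplaceIntegrand f z)) :
    ∃ B : ℝ, ∀ η : Fin N → ℝ, ∀ᵐ x : EuclideanSpace ℝ (Fin N),
      ‖f x‖ * Real.exp (∑ j, x j * η j) ≤ B * Real.exp (supportFun K η) := by
  obtain ⟨B, hB⟩ := h.exists_integral_norm_fourier_le
  refine ⟨B, fun η => ?_⟩
  filter_upwards [ae_eq_fourierInv_fourier (hi _) (h.integrable_fourier (hi (imagC η)))] with x hx
  rw [← norm_laplaceIntegrand_imagC, hx]
  exact (norm_fourierInv_le_integral_norm _ x).trans (hB η)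

/-- Replacing `η` by `n η` multiplies both exponents in the bound on `f` by `n`; let `n → ∞`. -/
theorem ae_eq_zero_of_supportFun_lt (h : PaleyWienerDecay K f)
    (hi : ∀ z, Integrable (laplaceIntegrand f z)) (η : Fin N → ℝ) :
    ∀ᵐ x : EuclideanSpace ℝ (Fin N), supportFun K η < ∑ j, x j * η j → f x = 0 := by
  obtain ⟨B, hB⟩ := h.exists_ae_norm_mul_exp_le hi
  filter_upwards [ae_all_iff.2 fun n : ℕ => hB ((n : ℝ) • η)] with x hx hlt
  refine eq_zero_of_norm_mul_exp_le (B := B) hlt fun n => ?_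
  simpa only [supportFun_smul K n.cast_nonneg, Pi.smul_apply, smul_eq_mul, mul_left_comm,
    ← Finset.mul_sum] using hx n

theorem ae_eq_fourierInv_fourier_and_mem_testFun (h : PaleyWienerDecay K f)
    (hKne : K.Nonempty) (hKconv : Convex ℝ K) (hKclosed : IsClosed K)
    (hi : ∀ z, Integrable (laplaceIntegrand f z)) :
    f =ᵐ[volume] 𝓕⁻ (𝓕 f) ∧ 𝓕⁻ (𝓕 f) ∈ testFun K := by
  have hzero : laplaceIntegrand f (imagC 0) = f := by rw [imagC_zero, laplaceIntegrand_zero]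
  have hf : Integrable f := by simpa only [hzero] using hi (imagC 0)
  have hmom (n : ℕ) : Integrable fun w => ‖w‖ ^ n * ‖𝓕 f w‖ := by
    simpa only [hzero] using h.integrable_norm_pow_mul_norm_fourier (hi (imagC 0)) n
  have hf' : Integrable (𝓕 f) := by simpa only [hzero] using h.integrable_fourier (hi (imagC 0))
  have hae := ae_eq_fourierInv_fourier hf hf'
  refine ⟨hae, contDiff_fourierInv fun n _ => hmom n, tsupport_subset_of_ae_halfSpace (μ := volume)
    hKconv hKclosed (continuous_fourierInv hf') fun ℓ u hℓu => ?_⟩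
  set η : Fin N → ℝ := fun j => ℓ (EuclideanSpace.single j 1)
  have hℓ (y) : ℓ y = ∑ j, y j * η j := by
    conv_lhs => rw [← (EuclideanSpace.basisFun (Fin N) ℝ).sum_repr y]
    simp [η]
  have hη : supportFun K η ≤ u := by
    refine csSup_le (hKne.image _) (forall_mem_image.2 fun y hy => ?_)
    simpa only [hℓ] using (hℓu y hy).le
  filter_upwards [hae, h.ae_eq_zero_of_supportFun_lt hi η] with x hx hx₀ hux
  rw [← hx]
  exact hx₀ (hη.trans_lt (hux.trans_eq (hℓ x)))

end PaleyWienerDecay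

end RapidDecay

section Beurling

variable {N : ℕ} {ω : ℝ → ℝ} {a b : ℝ} {K : Set (EuclideanSpace ℝ (Fin N))}
  {f : EuclideanSpace ℝ (Fin N) → ℂ}

theorem paleyWienerDecay_of_paleyWienerBound (hb : 0 < b)
    (hlog : ∀ t, 0 ≤ t → a + b * Real.log (1 + t) ≤ ω t)
    (h : ∀ l, PaleyWienerBound ω K l f) : PaleyWienerDecay K f := fun n => by
  simpa using (h (0 + n / b)).exists_one_add_sum_norm_pow_mul_le hb hlog

theorem PaleyWienerBound.lintegral_lt_top (hb : 0 < b)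
    (hlog : ∀ t, 0 ≤ t → a + b * Real.log (1 + t) ≤ ω t) {l : ℝ}
    (h : PaleyWienerBound ω K
      (l + (volume : Measure (EuclideanSpace ℝ (Fin N))).integrablePower / b) f) :
    ∫⁻ t, ‖fourierLaplace f (toC t)‖ₑ * ENNReal.ofReal (Real.exp (l * weightC ω (toC t))) < ∞ := by
  obtain ⟨C, hC⟩ := h.exists_one_add_sum_norm_pow_mul_le hb hlog
  simp only [← ofReal_norm, ← ENNReal.ofReal_mul (norm_nonneg _)]
  refine lintegral_ofReal_lt_top_of_one_add_norm_pow_mul_le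
    (C := C * Real.exp (supportFun K 0)) fun t => ?_
  have ht : ‖t‖ ≤ ∑ j, ‖toC t j‖ := by simpa [toC] using norm_le_sum_norm t
  calc (1 + ‖t‖) ^ _ * (‖fourierLaplace f (toC t)‖ * Real.exp (l * weightC ω (toC t)))
      ≤ (1 + ∑ j, ‖toC t j‖) ^ _ *
          (‖fourierLaplace f (toC t)‖ * Real.exp (l * weightC ω (toC t))) := by gcongr
    _ ≤ C * Real.exp (supportFun K 0) := hC (toC t)

theorem exists_mem_beurlingTestFun_of_paleyWienerBound (hb : 0 < b)
    (hlog : ∀ t, 0 ≤ t → a + b * Real.log (1 + t) ≤ ω t) (hKne : K.Nonempty)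
    (hKconv : Convex ℝ K) (hKclosed : IsClosed K) (hi : ∀ z, Integrable (laplaceIntegrand f z))
    (h : ∀ l, PaleyWienerBound ω K l f) : ∃ g, f =ᵐ[volume] g ∧ g ∈ beurlingTestFun ω K := by
  obtain ⟨hae, hmem⟩ :=
    (paleyWienerDecay_of_paleyWienerBound hb hlog h).ae_eq_fourierInv_fourier_and_mem_testFun
      hKne hKconv hKclosed hi
  exact ⟨_, hae, mem_iInter₂.2 fun l _ =>
    ⟨hmem, ((h _).congr_ae hae.symm).lintegral_lt_top hb hlog⟩⟩

end Beurling

end PaleyWienerBeurling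

open PaleyWienerBeurling in
theorem mainTheorem9_general {N : ℕ} {ω : ℝ → ℝ} (hnonneg : ∀ t, 0 ≤ t → 0 ≤ ω t)
    (hmono : MonotoneOn ω (Ici 0))
    (hα : ∃ A : ℝ, 1 ≤ A ∧ ∀ t, 0 ≤ t → ω (2 * t) ≤ A * (1 + ω t))
    (hγ : ∃ a b : ℝ, 0 < b ∧ ∀ t, 0 ≤ t → a + b * Real.log (1 + t) ≤ ω t)
    (hδ : ConvexOn ℝ (Ici 0) fun t => ω (Real.exp t))
    {K : Set (EuclideanSpace ℝ (Fin N))} (hKne : K.Nonempty) (hKconv : Convex ℝ K)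
    (hKcomp : IsCompact K) (f : EuclideanSpace ℝ (Fin N) → ℂ) :
    List.TFAE [
      ∃ g : EuclideanSpace ℝ (Fin N) → ℂ, f =ᵐ[volume] g ∧ g ∈ beurlingTestFun ω K,
      ∃ g : EuclideanSpace ℝ (Fin N) → ℂ, f =ᵐ[volume] g ∧ g ∈ testFun K ∧
        ∀ k : ℕ, 1 ≤ k → derivSup ω k g < ∞,
      (∀ z : Fin N → ℂ, Integrable (laplaceIntegrand f z)) ∧
        ∀ k : ℕ, 1 ≤ k → PaleyWienerBound ω K k f] := by
  obtain ⟨A, hA, hα⟩ := hα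
  obtain ⟨a, b, hb, hlog⟩ := hγ
  tfae_have 1 → 2
  | ⟨g, hfg, hg⟩ =>
    have hg' (k : ℕ) (hk : 1 ≤ k) : g ∈ testFunLam ω k K :=
      mem_iInter₂.1 hg k (mem_Ioi.2 (by exact_mod_cast hk))
    ⟨g, hfg, (hg' 1 le_rfl).1, fun k hk => derivSup_lt_top hnonneg hKcomp hk (hg' k hk)⟩
  tfae_have 2 → 3
  | ⟨g, hfg, hg, hd⟩ =>
    ⟨fun z => (integrable_laplaceIntegrand hKcomp hg z).congr
        (hfg.mono fun t ht => by simp only [laplaceIntegrand, ht]),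
      fun k _ => (paleyWienerBound_of_derivSup_lt_top hnonneg hmono (zero_le_one.trans hA) hα hb
        hlog hδ hKcomp hg hd k.cast_nonneg).congr_ae hfg⟩
  tfae_have 3 → 1
  | ⟨hi, hbound⟩ => by
    refine exists_mem_beurlingTestFun_of_paleyWienerBound hb hlog hKne hKconv hKcomp.isClosed hi
      fun l => ?_
    obtain ⟨k, hk⟩ := exists_nat_ge l
    exact (hbound (k + 1) k.succ_pos).mono hnonneg (hk.trans (by simp))
  tfae_finish

theorem mainTheorem9 {N : ℕ} (ω : ℝ → ℝ) (hω : PaleyWienerBeurling.IsWeight ω)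
    (K : Set (EuclideanSpace ℝ (Fin N))) (hKne : K.Nonempty) (hKconv : Convex ℝ K)
    (hKcomp : IsCompact K)
    (f : EuclideanSpace ℝ (Fin N) → ℂ) (hf : Integrable f) :
    List.TFAE [
      -- `f`, as an element of `L¹`, belongs to `𝒟_(ω)(K)`
      ∃ g : EuclideanSpace ℝ (Fin N) → ℂ,
        f =ᵐ[volume] g ∧ g ∈ PaleyWienerBeurling.beurlingTestFun ω K,
      -- `f`, as an element of `L¹`, belongs to `𝒟(K)` and satisfies the derivative bounds
      ∃ g : EuclideanSpace ℝ (Fin N) → ℂ,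
        f =ᵐ[volume] g ∧ g ∈ PaleyWienerBeurling.testFun K ∧
          ∀ k : ℕ, 1 ≤ k → PaleyWienerBeurling.derivSup ω k g < ∞,
      -- `f̂` is defined on all of `ℂᴺ` and satisfies the growth bounds
      (∀ z : Fin N → ℂ, Integrable (PaleyWienerBeurling.laplaceIntegrand f z)) ∧
        ∀ k : ℕ, 1 ≤ k → ∃ C : ℝ, 0 < C ∧ ∀ z : Fin N → ℂ,
          ‖PaleyWienerBeurling.fourierLaplace f z‖ ≤
            C * Real.exp (PaleyWienerBeurling.supportFun K (fun j => (z j).im)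
              - k * PaleyWienerBeurling.weightC ω z)] :=
  mainTheorem9_general hω.nonneg hω.monotoneOn hω.alpha hω.gamma' hω.delta hKne hKconv hKcomp f
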